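/- Let $\mathfrak A$ be a (not necessarily unital) $C^*$-algebra and let $H,K,E$ be Hilbert $\mathfrak A$-modules. Write $\mathcal L(H,K)$ for the set of adjointable operators from $H$ to $K$, $\mathcal L(H)=\mathcal L(H,H)$, $I_H$ for the identity operator on $H$, and $\mathcal R(T)$ for the range of $T$. The Moore–Penrose inverse $T^\dagger$ of $T\in\mathcal L(H,K)$, if it exists, is the unique $X\in\mathcal L(K,H)$ with $TXT=T$, $XTX=X$, $(TX)^*=TX$, $(XT)^*=XT$; in that case $T$ is called M-P invertible. An element of $\mathcal L(K)$ is called positive definite if it is self-adjoint, positive in the $C^*$-algebra $\mathcal L(K)$, and invertible in $\mathcal L(K)$. Let $A\in\mathcal L(H,K)$ and $B\in\mathcal L(H,E)$ be such that $(\mathcal R(A^*),\mathcal R(B^*))$ is a separated pair, that is, $$\mathcal R(A^*)\cap\mathcal R(B^*)=\{0\}\quad\text{and}\quad \mathcal R(A^*)+\mathcal R(B^*)\ \text{is closed in } H.$$ Then for all positive definite operators $V\in\mathcal L(K)$ and $W\in\mathcal L(E)$, the operators $A$, $B$, $A^*VA$ and $A^*VA+B^*WB$ are M-P invertible, $2I_H-A^\dagger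 A-B^\dagger B$ is invertible in $\mathcal L(H)$, and $$(A^*VA+B^*WB)^\dagger A^*V=(A^*VA)^\dagger A^*V-(I_H-A^\dagger A)\,\Pi,$$ where $\Pi\in\mathcal L(K,H)$ is defined by $$\Pi=(2I_H-A^\dagger A-B^\dagger B)^{-1}(A^*VA)^\dagger A^*V.$$ -/

import Mathlib

open scoped Pointwise

/-- `AdjointableMap 𝔄 H K` is the set `𝓛(H, K)` of adjointable operators between Hilbert
`𝔄`-modules: maps `T : H → K` for which there is a map `T⋆ : K → H` with
`⟪T x, y⟫ = ⟪x, T⋆ y⟫` for all `x`, `y`.  Such a `T` is automatically linear (see `map_add`,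
`map_smul`, `map_smul_complex`) and bounded, and `T⋆` is uniquely determined by `T`
(see `ext`), so that carrying it as a field adds no data. -/
structure AdjointableMap (𝔄 H K : Type*) [Inner 𝔄 H] [Inner 𝔄 K] where
  /-- the operator -/
  toFun : H → K
  /-- the adjoint of the operator -/
  adjFun : K → H
  inner_toFun : ∀ x y, inner 𝔄 (toFun x) y = inner 𝔄 x (adjFun y)

namespace AdjointableMap

section

variable {𝔄 H K E F : Type*} [NonUnitalCStarAlgebra 𝔄] [PartialOrder 𝔄]
  [NormedAddCommGroup H] [NormedSpace ℂ H] [SMul 𝔄 H] [CStarModule 𝔄 H]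
  [NormedAddCommGroup K] [NormedSpace ℂ K] [SMul 𝔄 K] [CStarModule 𝔄 K]
  [NormedAddCommGroup E] [NormedSpace ℂ E] [SMul 𝔄 E] [CStarModule 𝔄 E]
  [NormedAddCommGroup F] [NormedSpace ℂ F] [SMul 𝔄 F] [CStarModule 𝔄 F]

instance : CoeFun (AdjointableMap 𝔄 H K) (fun _ => H → K) := ⟨toFun⟩

variable (𝔄) in
theorem eq_of_inner_left {y z : H} (h : ∀ x : H, inner 𝔄 x y = inner 𝔄 x z) : y = z := by
  have h1 : inner 𝔄 (y - z) (y - z) = 0 := by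
    rw [CStarModule.inner_sub_right, h, sub_self]
  exact sub_eq_zero.mp (CStarModule.inner_self.mp h1)

/-- The Hermitian adjoint `T⋆`. -/
def adjoint (T : AdjointableMap 𝔄 H K) : AdjointableMap 𝔄 K H where
  toFun := T.adjFun
  adjFun := T.toFun
  inner_toFun x y := by
    rw [← CStarModule.star_inner y, ← T.inner_toFun, CStarModule.star_inner]

theorem inner_left (T : AdjointableMap 𝔄 H K) (x : H) (y : K) :
    inner 𝔄 (T x) y = inner 𝔄 x (T.adjoint y) := T.inner_toFun x y

theorem inner_right (T : AdjointableMap 𝔄 H K) (x : K) (y : H) :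
    inner 𝔄 x (T y) = inner 𝔄 (T.adjoint x) y := (T.adjoint.inner_toFun x y).symm

@[ext]
theorem ext {T S : AdjointableMap 𝔄 H K} (h : ∀ x, T x = S x) : T = S := by
  have h1 : T.toFun = S.toFun := funext h
  have h2 : T.adjFun = S.adjFun := by
    funext y
    refine eq_of_inner_left 𝔄 fun x => ?_
    rw [← T.inner_toFun, ← S.inner_toFun, h1]
  cases T
  cases S
  simp_all

theorem map_add (T : AdjointableMap 𝔄 H K) (x y : H) : T (x + y) = T x + T y :=
  eq_of_inner_left 𝔄 fun z => by
    simp only [inner_right, CStarModule.inner_add_right]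

theorem map_smul (T : AdjointableMap 𝔄 H K) (a : 𝔄) (x : H) : T (a • x) = a • T x :=
  eq_of_inner_left 𝔄 fun z => by
    simp only [inner_right, CStarModule.inner_op_smul_right]

theorem map_smul_complex (T : AdjointableMap 𝔄 H K) (c : ℂ) (x : H) : T (c • x) = c • T x :=
  eq_of_inner_left 𝔄 fun z => by
    simp only [inner_right, CStarModule.inner_smul_right_complex]

theorem map_zero (T : AdjointableMap 𝔄 H K) : T 0 = 0 := by
  simpa using T.map_smul_complex 0 0

theorem map_neg (T : AdjointableMap 𝔄 H K) (x : H) : T (-x) = -T x := by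
  simpa using T.map_smul_complex (-1) x

@[simp] theorem adjoint_adjoint (T : AdjointableMap 𝔄 H K) : T.adjoint.adjoint = T := rfl

/-- Composition of adjointable operators, with `(S T)⋆ = T⋆ S⋆`. -/
def comp (S : AdjointableMap 𝔄 K E) (T : AdjointableMap 𝔄 H K) : AdjointableMap 𝔄 H E where
  toFun x := S (T x)
  adjFun y := T.adjoint (S.adjoint y)
  inner_toFun x y := by rw [inner_left, inner_left]

instance : Zero (AdjointableMap 𝔄 H K) where
  zero :=
    { toFun := fun _ => 0
      adjFun := fun _ => 0
      inner_toFun := fun x y => by simp }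

instance : Add (AdjointableMap 𝔄 H K) where
  add S T :=
    { toFun := fun x => S x + T x
      adjFun := fun y => S.adjoint y + T.adjoint y
      inner_toFun := fun x y => by simp [inner_left] }

instance : Neg (AdjointableMap 𝔄 H K) where
  neg S :=
    { toFun := fun x => -S x
      adjFun := fun y => -S.adjoint y
      inner_toFun := fun x y => by simp [inner_left] }

@[simp] theorem zero_apply (x : H) : (0 : AdjointableMap 𝔄 H K) x = 0 := rfl
@[simp] theorem add_apply (S T : AdjointableMap 𝔄 H K) (x : H) : (S + T) x = S x + T x := rfl
@[simp] theorem neg_apply (S : AdjointableMap 𝔄 H K) (x : H) : (-S) x = -S x := rfl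
@[simp] theorem comp_apply (S : AdjointableMap 𝔄 K E) (T : AdjointableMap 𝔄 H K) (x : H) :
    S.comp T x = S (T x) := rfl

/-- `𝓛(H, K)` is an additive group under pointwise addition. -/
instance : AddCommGroup (AdjointableMap 𝔄 H K) where
  add_assoc _ _ _ := ext fun _ => add_assoc _ _ _
  zero_add _ := ext fun _ => zero_add _
  add_zero _ := ext fun _ => add_zero _
  add_comm _ _ := ext fun _ => add_comm _ _
  neg_add_cancel _ := ext fun _ => neg_add_cancel _
  nsmul := nsmulRec
  zsmul := zsmulRec

instance : One (AdjointableMap 𝔄 H H) where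
  one :=
    { toFun := fun x => x
      adjFun := fun y => y
      inner_toFun := fun _ _ => rfl }

instance : Mul (AdjointableMap 𝔄 H H) where
  mul := comp

@[simp] theorem one_apply (x : H) : (1 : AdjointableMap 𝔄 H H) x = x := rfl
@[simp] theorem mul_apply (S T : AdjointableMap 𝔄 H H) (x : H) : (S * T) x = S (T x) := rfl
theorem mul_eq_comp (S T : AdjointableMap 𝔄 H H) : S * T = S.comp T := rfl
@[simp] theorem sub_apply (S T : AdjointableMap 𝔄 H K) (x : H) : (S - T) x = S x - T x := by
  rw [sub_eq_add_neg, sub_eq_add_neg, add_apply, neg_apply]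

/-- `𝓛(H) = 𝓛(H, H)` is a ring under composition, with unit the identity operator. -/
instance : Ring (AdjointableMap 𝔄 H H) where
  left_distrib S _ _ := ext fun _ => S.map_add _ _
  right_distrib _ _ _ := ext fun _ => rfl
  zero_mul _ := ext fun _ => rfl
  mul_zero S := ext fun _ => S.map_zero
  mul_assoc _ _ _ := ext fun _ => rfl
  one_mul _ := ext fun _ => rfl
  mul_one _ := ext fun _ => rfl
  neg_add_cancel := neg_add_cancel
  zsmul := zsmulRec

/-- `𝓛(H)` is a `⋆`-ring, the involution being the adjoint. -/
instance : StarRing (AdjointableMap 𝔄 H H) where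
  star := adjoint
  star_involutive _ := rfl
  star_mul _ _ := rfl
  star_add _ _ := rfl

theorem star_eq_adjoint (S : AdjointableMap 𝔄 H H) : star S = S.adjoint := rfl

/-- Positive elements of the `C⋆`-algebra `𝓛(H)`: those of the form `S⋆ S`. -/
def IsPositive (T : AdjointableMap 𝔄 H H) : Prop :=
  ∃ S : AdjointableMap 𝔄 H H, T = star S * S

/-- A positive definite operator: self-adjoint, invertible in `𝓛(H)`, and positive. -/
structure IsPosDef (T : AdjointableMap 𝔄 H H) : Prop where
  isSelfAdjoint : IsSelfAdjoint T
  isUnit : IsUnit T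
  isPositive : T.IsPositive

/-- `X` is a Moore-Penrose inverse of `T`. -/
structure IsMPInverse (T : AdjointableMap 𝔄 H K) (X : AdjointableMap 𝔄 K H) : Prop where
  comp_comp_self : (T.comp X).comp T = T
  self_comp_comp : (X.comp T).comp X = X
  adjoint_comp_right : (T.comp X).adjoint = T.comp X
  adjoint_comp_left : (X.comp T).adjoint = X.comp T

/-- `T` is M-P invertible: it has a Moore-Penrose inverse in `𝓛(K, H)`. -/
def IsMPInvertible (T : AdjointableMap 𝔄 H K) : Prop :=
  ∃ X : AdjointableMap 𝔄 K H, T.IsMPInverse X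

theorem comp_assoc (R : AdjointableMap 𝔄 E F) (S : AdjointableMap 𝔄 K E)
    (T : AdjointableMap 𝔄 H K) : (R.comp S).comp T = R.comp (S.comp T) := rfl

theorem adjoint_comp (S : AdjointableMap 𝔄 K E) (T : AdjointableMap 𝔄 H K) :
    (S.comp T).adjoint = T.adjoint.comp S.adjoint := rfl

/-- The Moore-Penrose inverse is unique. -/
theorem IsMPInverse.unique {T : AdjointableMap 𝔄 H K} {X Y : AdjointableMap 𝔄 K H}
    (hX : T.IsMPInverse X) (hY : T.IsMPInverse Y) : X = Y := by
  have h1 : T.comp X = T.comp Y := by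
    calc T.comp X = ((T.comp Y).comp T).comp X := by rw [hY.comp_comp_self]
      _ = (T.comp Y).adjoint.comp (T.comp X).adjoint := by
          rw [hX.adjoint_comp_right, hY.adjoint_comp_right, comp_assoc]
      _ = (((T.comp X).comp T).comp Y).adjoint := rfl
      _ = T.comp Y := by rw [hX.comp_comp_self, hY.adjoint_comp_right]
  have h2 : X.comp T = Y.comp T := by
    calc X.comp T = X.comp ((T.comp Y).comp T) := by rw [hY.comp_comp_self]
      _ = (X.comp T).adjoint.comp (Y.comp T).adjoint := by
          rw [hX.adjoint_comp_left, hY.adjoint_comp_left]; rfl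
      _ = (Y.comp ((T.comp X).comp T)).adjoint := rfl
      _ = Y.comp T := by rw [hX.comp_comp_self, hY.adjoint_comp_left]
  calc X = (X.comp T).comp X := hX.self_comp_comp.symm
    _ = Y.comp (T.comp X) := by rw [h2]; rfl
    _ = (Y.comp T).comp Y := by rw [h1]; rfl
    _ = Y := hY.self_comp_comp

open Classical in
/-- The Moore-Penrose inverse `T†` of an M-P invertible operator (and `0` otherwise). -/
noncomputable def mpInv (T : AdjointableMap 𝔄 H K) : AdjointableMap 𝔄 K H :=
  if h : T.IsMPInvertible then h.choose else 0

theorem IsMPInvertible.isMPInverse_mpInv {T : AdjointableMap 𝔄 H K} (h : T.IsMPInvertible) :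
    T.IsMPInverse T.mpInv := by
  rw [mpInv, dif_pos h]
  exact h.choose_spec

/-- `(R(A⋆), R(B⋆))` is a separated pair: `R(A⋆) ∩ R(B⋆) = {0}` and `R(A⋆) + R(B⋆)` is closed. -/
def IsSeparatedPair (A : AdjointableMap 𝔄 H K) (B : AdjointableMap 𝔄 H E) : Prop :=
  Set.range A.adjoint ∩ Set.range B.adjoint = {0} ∧
    IsClosed (Set.range A.adjoint + Set.range B.adjoint)

end

end AdjointableMap

infixr:80 " ∘ₐ " => AdjointableMap.comp

/-! Let `P = A†A`, `Q = B†B` be the orthogonal projections onto `R(A⋆)`, `R(B⋆)`, and `D = 2 - P -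
Q`. A separated pair makes `D` bounded below (`IsSeparatedPair.isUnit`), so `N = (1 - Q)D⁻¹` exists.
As `P(1 - Q) = PD`, it satisfies `PN = P` and `QN = 0`, that is, `AN = A` and `BN = 0`. Put `G =
A⋆VA` and `M = G + B⋆WB`. Then `MN = G` and `M(1 - N) = B⋆WB`, so `R(M) = R(A⋆) + R(B⋆)` is closed
and `M†` exists. With `z = G†A⋆Vk`, `A⋆Vk = Gz = MNz`, hence `M†A⋆Vk = M†M(Nz)`. The projection
`M†M` fixes `Nz`, and `N = 1 - (1 - P)D⁻¹` gives the formula. Moore-Penrose inverses come from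
closed ranges (`isMPInvertible_of_isClosed_range`). Closed submodules need not be complemented, so
the projection onto the range is built by inverting `TT⋆` there. -/

/-- An operator on a complex Banach space whose translates by imaginary scalars are uniformly bounded
below is invertible. -/
theorem ContinuousLinearMap.isUnit_of_forall_imaginary_bound {F : Type*} [NormedAddCommGroup F]
    [NormedSpace ℂ F] [CompleteSpace F] (f : F →L[ℂ] F) {c : ℝ} (hc : 0 < c)
    (hf : ∀ (t : ℝ) (x : F), c * ‖x‖ ≤ ‖(t * Complex.I) • x - f x‖) : IsUnit f := by
  rcases subsingleton_or_nontrivial (F →L[ℂ] F) with h | h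
  · exact isUnit_of_subsingleton f
  set g : ℝ → (F →L[ℂ] F) := fun t => algebraMap ℂ _ (t * Complex.I) - f with hg
  have hgapp : ∀ t x, g t x = (t * Complex.I) • x - f x := fun t x => by
    simp [hg, Algebra.algebraMap_eq_smul_one]
  -- The resolvent has norm at most `c⁻¹` wherever it exists, so the Neumann series has radius at
  -- least `c` at every such point. The good set is therefore clopen in the connected line.
  have hstep : ∀ s t : ℝ, dist s t < c → IsUnit (g t) → IsUnit (g s) := by
    rintro s t hst ⟨u, hu⟩
    have hinv : ‖(↑u⁻¹ : F →L[ℂ] F)‖ ≤ c⁻¹ := by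
      refine ContinuousLinearMap.opNorm_le_bound _ (by positivity) fun x => ?_
      have h1 := hf t ((↑u⁻¹ : F →L[ℂ] F) x)
      rw [← hgapp, ← hu, ← mul_apply_eq_comp, Units.mul_inv,
        one_apply_eq_self] at h1
      rwa [inv_mul_eq_div, le_div_iff₀' hc]
    have hpos : 0 < ‖(↑u⁻¹ : F →L[ℂ] F)‖ := norm_pos_iff.mpr u⁻¹.ne_zero
    refine (u.ofNearby (g s) ?_).isUnit
    have h2 : g s - u = ((s - t : ℝ) * Complex.I) • (1 : F →L[ℂ] F) := by
      rw [hu]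
      simp only [hg, Algebra.algebraMap_eq_smul_one, sub_sub_sub_cancel_right, ← sub_smul]
      push_cast
      rw [sub_mul]
    calc ‖g s - u‖ ≤ ‖((s - t : ℝ) * Complex.I)‖ * ‖(1 : F →L[ℂ] F)‖ := by
          rw [h2, norm_smul]
      _ ≤ dist s t * 1 := by
          refine mul_le_mul (le_of_eq ?_) ContinuousLinearMap.norm_id_le (norm_nonneg _) dist_nonneg
          rw [norm_mul, Complex.norm_I, mul_one, Complex.norm_real, Real.dist_eq, Real.norm_eq_abs]
      _ < c := by rwa [mul_one]
      _ ≤ _ := by rwa [le_inv_comm₀ hc hpos]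
  have huniv : {t : ℝ | IsUnit (g t)} = Set.univ := by
    refine IsClopen.eq_univ ⟨⟨Metric.isOpen_iff.mpr fun t ht => ?_⟩,
      Metric.isOpen_iff.mpr fun t ht => ?_⟩ ⟨‖f‖ + 1, ?_⟩
    · exact ⟨c, hc, fun s hs hs' => ht (hstep t s (by rwa [dist_comm]) hs')⟩
    · exact ⟨c, hc, fun s hs => hstep s t hs ht⟩
    · have hone : ‖(1 : F →L[ℂ] F)‖ ≤ 1 := ContinuousLinearMap.norm_id_le
      refine spectrum.mem_resolventSet_of_norm_lt_mul (a := f) ?_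
      have : ‖(((‖f‖ + 1 : ℝ) : ℂ) * Complex.I)‖ = ‖f‖ + 1 := by
        rw [norm_mul, Complex.norm_I, mul_one, Complex.norm_real, Real.norm_eq_abs,
          abs_of_nonneg (by positivity)]
      rw [this]
      nlinarith [norm_nonneg f]
  have h0 : IsUnit (g 0) := by
    have : (0 : ℝ) ∈ {t : ℝ | IsUnit (g t)} := huniv ▸ Set.mem_univ _
    exact this
  have h3 : g 0 = -f := by simp [hg]
  rw [h3] at h0
  exact IsUnit.neg_iff f |>.mp h0

/-! ### Boundedness and the closed range theorem -/

namespace AdjointableMap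

variable {𝔄 H K E : Type*} [NonUnitalCStarAlgebra 𝔄] [PartialOrder 𝔄]
  [NormedAddCommGroup H] [NormedSpace ℂ H] [SMul 𝔄 H] [CStarModule 𝔄 H]
  [NormedAddCommGroup K] [NormedSpace ℂ K] [SMul 𝔄 K] [CStarModule 𝔄 K]
  [NormedAddCommGroup E] [NormedSpace ℂ E] [SMul 𝔄 E] [CStarModule 𝔄 E]

/-- An adjointable operator as a linear map. -/
def toLinearMap (T : AdjointableMap 𝔄 H K) : H →ₗ[ℂ] K where
  toFun := T
  map_add' := T.map_add
  map_smul' := T.map_smul_complex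

theorem eq_zero_of_adjoint_comp_self (T : AdjointableMap 𝔄 H K) {x : H}
    (h : T.adjoint (T x) = 0) : T x = 0 := by
  refine (CStarModule.inner_self (A := 𝔄)).mp ?_
  rw [T.inner_left, h, CStarModule.inner_zero_right]

variable [StarOrderedRing 𝔄]

/-- The norm is monotone in the inner square. -/
theorem norm_le_of_inner_self_le {x : H} {y : K} (h : inner 𝔄 x x ≤ inner 𝔄 y y) :
    ‖x‖ ≤ ‖y‖ := by
  rw [CStarModule.norm_eq_sqrt_norm_inner_self (A := 𝔄) x,
    CStarModule.norm_eq_sqrt_norm_inner_self (A := 𝔄) y]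
  exact Real.sqrt_le_sqrt
    (CStarAlgebra.norm_le_norm_of_nonneg_of_le CStarModule.inner_self_nonneg h)

variable (𝔄) in
/-- A symmetric operator which is bounded below on a complete subspace is invertible there. -/
theorem isUnit_of_symmetric_of_bound (F : Submodule ℂ H) [CompleteSpace F] (S : F →L[ℂ] F)
    (hS : ∀ x y : F, inner 𝔄 (S x : H) (y : H) = inner 𝔄 (x : H) (S y : H))
    {c : ℝ} (hc : 0 < c) (hb : ∀ x, c * ‖x‖ ≤ ‖S x‖) : IsUnit S := by
  refine S.isUnit_of_forall_imaginary_bound hc fun t x => (hb x).trans ?_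
  change ‖(S x : H)‖ ≤ ‖((t * Complex.I) • (x : H) - (S x : H))‖
  refine norm_le_of_inner_self_le (𝔄 := 𝔄) ?_
  -- Pythagoras: the cross terms cancel because `S` is symmetric and the scalar is purely imaginary.
  have : inner 𝔄 ((t * Complex.I) • (x : H) - (S x : H)) ((t * Complex.I) • (x : H) - (S x : H))
      = inner 𝔄 ((t * Complex.I) • (x : H)) ((t * Complex.I) • (x : H))
        + inner 𝔄 (S x : H) (S x : H) := by
    simp only [CStarModule.inner_sub_right, CStarModule.inner_sub_left, hS,
      CStarModule.inner_smul_right_complex, CStarModule.inner_smul_left_complex]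
    simp only [star_mul', Complex.star_def, Complex.conj_I, Complex.conj_ofReal]
    module
  rw [this]
  exact le_add_of_nonneg_left CStarModule.inner_self_nonneg

/-- An adjointable operator between Hilbert modules is bounded, by the closed graph theorem. -/
theorem continuous [CompleteSpace H] [CompleteSpace K] (T : AdjointableMap 𝔄 H K) :
    Continuous T := by
  refine T.toLinearMap.continuous_of_seq_closed_graph fun u x y hu hTu => ?_
  refine eq_of_inner_left 𝔄 fun z => ?_
  have h1 := (((CStarModule.innerSL (A := 𝔄) z).continuous.tendsto y).comp hTu)
  have h2 := (((CStarModule.innerSL (A := 𝔄) (T.adjoint z)).continuous.tendsto x).comp hu)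
  refine (tendsto_nhds_unique h1 (h2.congr fun n => ?_)).trans (T.inner_right z x).symm
  exact (T.inner_right z (u n)).symm

/-- An adjointable operator between Hilbert modules as a continuous linear map. -/
def toCLM [CompleteSpace H] [CompleteSpace K] (T : AdjointableMap 𝔄 H K) : H →L[ℂ] K where
  toLinearMap := T.toLinearMap
  cont := T.continuous

@[simp] theorem toCLM_apply [CompleteSpace H] [CompleteSpace K] (T : AdjointableMap 𝔄 H K) (x : H) :
    T.toCLM x = T x := rfl

/-- An adjointable operator with closed range is Moore-Penrose invertible. -/
theorem isMPInvertible_of_isClosed_range [CompleteSpace H] [CompleteSpace K]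
    (T : AdjointableMap 𝔄 H K) (hT : IsClosed (Set.range T)) : T.IsMPInvertible := by
  set F : Submodule ℂ K := LinearMap.range T.toLinearMap with hF
  have hTF : ∀ x, T x ∈ F := fun x => ⟨x, rfl⟩
  have hFc : IsClosed (F : Set K) := by
    rw [hF, LinearMap.coe_range]; exact hT
  have : CompleteSpace F := hFc.completeSpace_coe
  let T' : H →L[ℂ] F := T.toCLM.codRestrict F hTF
  have hT's : Function.Surjective T' := by
    rintro ⟨_, x, rfl⟩
    exact ⟨x, rfl⟩
  let S : F →L[ℂ] F := T'.comp (T.adjoint.toCLM.comp F.subtypeL)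
  have hSapp : ∀ x : F, (S x : K) = T (T.adjoint x) := fun x => rfl
  have hsymm : ∀ x y : F, inner 𝔄 (S x : K) (y : K) = inner 𝔄 (x : K) (S y : K) := fun x y => by
    rw [hSapp, hSapp, T.inner_left, T.inner_right]
  obtain ⟨C, hC, hCT⟩ := T'.exists_preimage_norm_le hT's
  -- Pairing `x = T z` with itself, where the open mapping theorem controls `z`, bounds `T⋆` below
  -- on the range.
  have hadj : ∀ x : F, ‖x‖ ≤ C * ‖T.adjoint x‖ := fun x => by
    obtain ⟨z, hz, hzx⟩ := hCT x
    rcases eq_or_lt_of_le (norm_nonneg x) with h0 | h0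
    · rw [← h0]; positivity
    refine le_of_mul_le_mul_right ?_ h0
    calc ‖x‖ * ‖x‖ = ‖inner 𝔄 (T.adjoint x) z‖ := by
          rw [← T.inner_right]
          have : T z = x := by rw [← hz]; rfl
          rw [this, ← CStarModule.norm_sq_eq, sq]; rfl
      _ ≤ ‖T.adjoint x‖ * ‖z‖ := CStarModule.norm_inner_le H
      _ ≤ ‖T.adjoint x‖ * (C * ‖x‖) := by gcongr
      _ = C * ‖T.adjoint x‖ * ‖x‖ := by ring
  have hb : ∀ x : F, (C ^ 2)⁻¹ * ‖x‖ ≤ ‖S x‖ := fun x => by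
    rw [inv_mul_le_iff₀ (by positivity)]
    rcases eq_or_lt_of_le (norm_nonneg x) with h0 | h0
    · rw [← h0]; positivity
    refine le_of_mul_le_mul_right ?_ h0
    calc ‖x‖ * ‖x‖ ≤ (C * ‖T.adjoint x‖) * (C * ‖T.adjoint x‖) := by
          gcongr <;> exact hadj x
      _ = C ^ 2 * ‖inner 𝔄 (T.adjoint x) (T.adjoint x)‖ := by
          rw [← CStarModule.norm_sq_eq]; ring
      _ = C ^ 2 * ‖inner 𝔄 (S x : K) (x : K)‖ := by rw [hSapp, T.inner_left]
      _ ≤ C ^ 2 * (‖S x‖ * ‖x‖) := by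
          gcongr; exact CStarModule.norm_inner_le K
      _ = _ := by ring
  obtain ⟨u, hu⟩ := isUnit_of_symmetric_of_bound 𝔄 F S hsymm (by positivity) hb
  set G : F →L[ℂ] F := ↑u⁻¹
  have hSG : ∀ x, S (G x) = x := fun x => by
    rw [← hu, ← mul_apply_eq_comp, Units.mul_inv, one_apply_eq_self]
  have hGS : ∀ x, G (S x) = x := fun x => by
    rw [← hu, ← mul_apply_eq_comp, Units.inv_mul, one_apply_eq_self]
  have hGsymm : ∀ x y : F, inner 𝔄 (G x : K) (y : K) = inner 𝔄 (x : K) (G y : K) := fun x y => by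
    conv_lhs => rw [← hSG y, ← hsymm, hSG]
  -- the orthogonal projection onto the range
  let p : K → F := fun y => G (T' (T.adjoint y))
  -- `TT⋆` agrees on `p y` and `y`, and `TT⋆` has the same kernel as `T⋆`.
  have hp : ∀ y, T.adjoint (p y) = T.adjoint y := fun y => by
    have h1 : T (T.adjoint (p y)) = T (T.adjoint y) :=
      congrArg Subtype.val (hSG (T' (T.adjoint y)))
    have h2 : T.adjoint (p y - y) = 0 := by
      refine eq_zero_of_adjoint_comp_self T.adjoint ?_
      rw [sub_eq_add_neg, map_add, map_neg, adjoint_adjoint, map_add, map_neg, h1, add_neg_cancel]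
    rw [sub_eq_add_neg, map_add, map_neg, ← sub_eq_add_neg] at h2
    exact sub_eq_zero.mp h2
  have hpi : ∀ (x : F) (y : K), inner 𝔄 (x : K) (p y : K) = inner 𝔄 (x : K) y := fun x y => by
    obtain ⟨z, hz⟩ := x.2
    have hz : T z = x := hz
    rw [← hz, T.inner_left, T.inner_left, hp]
  have hpF : ∀ x : F, p x = x := fun x => hGS x
  -- `X = T⋆(TT⋆)⁻¹p`, the inverse being taken on the range, so that `TX = p`.
  let X : AdjointableMap 𝔄 K H :=
    { toFun := fun y => T.adjoint (G (p y))
      adjFun := fun h => G (T' h)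
      inner_toFun := fun y h => by
        have h1 : T h = S (G (T' h)) := (congrArg Subtype.val (hSG (T' h))).symm
        rw [← T.inner_right, h1, ← hsymm, hSG, ← CStarModule.star_inner, hpi,
          CStarModule.star_inner] }
  have hTX : ∀ y, T (X y) = p y := fun y => congrArg Subtype.val (hSG (p y))
  refine ⟨X, ⟨ext fun h => ?_, ext fun y => ?_, ext fun y => (hTX y).symm, ext fun h => ?_⟩⟩
  · exact (hTX (T h)).trans (congrArg Subtype.val (hpF (T' h)))
  · change T.adjoint (G (p (T (X y)))) = T.adjoint (G (p y))
    rw [hTX, hpF]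
  · change T.adjoint (G (T' h)) = T.adjoint (G (p (T' h)))
    rw [hpF]

end AdjointableMap
-- Algebra of Moore-Penrose inverses and separated pairs
namespace AdjointableMap

section
variable {𝔄 H K E : Type*} [NonUnitalCStarAlgebra 𝔄] [PartialOrder 𝔄]
  [NormedAddCommGroup H] [NormedSpace ℂ H] [SMul 𝔄 H] [CStarModule 𝔄 H]
  [NormedAddCommGroup K] [NormedSpace ℂ K] [SMul 𝔄 K] [CStarModule 𝔄 K]
  [NormedAddCommGroup E] [NormedSpace ℂ E] [SMul 𝔄 E] [CStarModule 𝔄 E]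

theorem map_sub (T : AdjointableMap 𝔄 H K) (x y : H) : T (x - y) = T x - T y :=
  T.toLinearMap.map_sub x y

theorem IsMPInverse.adjoint {T : AdjointableMap 𝔄 H K} {X : AdjointableMap 𝔄 K H}
    (h : T.IsMPInverse X) : T.adjoint.IsMPInverse X.adjoint where
  comp_comp_self := congrArg AdjointableMap.adjoint h.comp_comp_self
  self_comp_comp := congrArg AdjointableMap.adjoint h.self_comp_comp
  adjoint_comp_right := congrArg AdjointableMap.adjoint h.adjoint_comp_left
  adjoint_comp_left := congrArg AdjointableMap.adjoint h.adjoint_comp_right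

theorem IsMPInvertible.of_adjoint {T : AdjointableMap 𝔄 H K} (h : T.adjoint.IsMPInvertible) :
    T.IsMPInvertible :=
  let ⟨_, hX⟩ := h
  ⟨_, hX.adjoint⟩

theorem IsMPInverse.apply_apply_self {T : AdjointableMap 𝔄 H K} {X : AdjointableMap 𝔄 K H}
    (h : T.IsMPInverse X) (x : H) : T (X (T x)) = T x :=
  congrArg (fun S : AdjointableMap 𝔄 H K => S x) h.comp_comp_self

theorem IsMPInverse.adjoint_apply_eq {T : AdjointableMap 𝔄 H K} {X : AdjointableMap 𝔄 K H}
    (h : T.IsMPInverse X) (x : H) : T.adjoint (X.adjoint x) = X (T x) :=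
  congrArg (fun S : AdjointableMap 𝔄 H H => S x) h.adjoint_comp_left

/-- `X T` fixes the range of `T⋆`. -/
theorem IsMPInverse.apply_adjoint {T : AdjointableMap 𝔄 H K} {X : AdjointableMap 𝔄 K H}
    (h : T.IsMPInverse X) (y : K) : X (T (T.adjoint y)) = T.adjoint y := by
  rw [← h.adjoint_apply_eq]
  exact h.adjoint.apply_apply_self y

/-- The Moore-Penrose inverse of `T⋆ T` is `T† (T†)⋆`. -/
theorem IsMPInverse.adjoint_comp_self {T : AdjointableMap 𝔄 H K} {X : AdjointableMap 𝔄 K H}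
    (h : T.IsMPInverse X) : (T.adjoint ∘ₐ T).IsMPInverse (X ∘ₐ X.adjoint) := by
  have h1 : ∀ y, T (X y) = X.adjoint (T.adjoint y) := fun y => h.adjoint.adjoint_apply_eq y
  have hl : (X ∘ₐ X.adjoint) ∘ₐ (T.adjoint ∘ₐ T) = X ∘ₐ T := by
    ext x
    simp only [comp_apply]
    rw [← h1, h.apply_apply_self]
  have hr : (T.adjoint ∘ₐ T) ∘ₐ (X ∘ₐ X.adjoint) = X ∘ₐ T := by
    ext x
    simp only [comp_apply]
    rw [h1, h.adjoint.apply_apply_self, h.adjoint_apply_eq]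
  refine ⟨?_, ?_, ?_, ?_⟩
  · rw [hr]; ext x; exact h.apply_adjoint (T x)
  · rw [hl]; ext x
    simpa only [comp_apply] using congrArg (fun S : AdjointableMap 𝔄 K H => S (X.adjoint x))
      h.self_comp_comp
  · rw [hr, h.adjoint_comp_left]
  · rw [hl, h.adjoint_comp_left]

/-- `1 - X T` is an orthogonal projection. -/
theorem IsMPInverse.inner_sub_apply_apply {T : AdjointableMap 𝔄 H K} {X : AdjointableMap 𝔄 K H}
    (h : T.IsMPInverse X) (x : H) :
    inner 𝔄 (x - X (T x)) x = inner 𝔄 (x - X (T x)) (x - X (T x)) := by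
  conv_rhs => rw [CStarModule.inner_sub_right]
  rw [eq_comm, sub_eq_self]
  conv_lhs => rw [← h.adjoint_apply_eq x, T.adjoint.inner_right, adjoint_adjoint, map_sub,
    h.adjoint_apply_eq x, h.apply_apply_self, sub_self, CStarModule.inner_zero_left]

theorem IsSeparatedPair.symm {A : AdjointableMap 𝔄 H K} {B : AdjointableMap 𝔄 H E}
    (h : A.IsSeparatedPair B) : B.IsSeparatedPair A :=
  ⟨by rw [Set.inter_comm]; exact h.1, by rw [add_comm]; exact h.2⟩

theorem IsSeparatedPair.eq_of_add_eq {A : AdjointableMap 𝔄 H K} {B : AdjointableMap 𝔄 H E}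
    (h : A.IsSeparatedPair B) {k k' : K} {e e' : E}
    (heq : A.adjoint k + B.adjoint e = A.adjoint k' + B.adjoint e') :
    A.adjoint k = A.adjoint k' := by
  have h1 : A.adjoint (k - k') = B.adjoint (e' - e) := by
    rw [map_sub, map_sub, sub_eq_sub_iff_add_eq_add, heq, add_comm]
  have h2 : A.adjoint (k - k') ∈ Set.range A.adjoint ∩ Set.range B.adjoint :=
    ⟨⟨_, rfl⟩, ⟨_, h1.symm⟩⟩
  rw [h.1, Set.mem_singleton_iff, map_sub] at h2
  exact sub_eq_zero.mp h2

/-- This turns `A⋆VA` into `(SA)⋆(SA)` with `R((SA)⋆) = R(A⋆)`. Surjectivity holds because `SV⁻¹` is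
a right inverse of `S⋆`. -/
theorem IsPosDef.exists_factor {V : AdjointableMap 𝔄 K K} (hV : V.IsPosDef) :
    ∃ S : AdjointableMap 𝔄 K K, V = S.adjoint ∘ₐ S ∧ Function.Surjective S.adjoint := by
  obtain ⟨S, hS⟩ := hV.isPositive
  refine ⟨S, hS, fun y => ?_⟩
  obtain ⟨u, hu⟩ := hV.isUnit
  refine ⟨S ((↑u⁻¹ : AdjointableMap 𝔄 K K) y), ?_⟩
  have h1 : V * ↑u⁻¹ = 1 := by rw [← hu, Units.mul_inv]
  rw [hS] at h1
  exact congrArg (fun R : AdjointableMap 𝔄 K K => R y) h1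

end

/-! ### Norm estimates and invertibility for separated pairs -/

variable {𝔄 H K E : Type*} [NonUnitalCStarAlgebra 𝔄] [PartialOrder 𝔄] [StarOrderedRing 𝔄]
  [NormedAddCommGroup H] [NormedSpace ℂ H] [SMul 𝔄 H] [CStarModule 𝔄 H] [CompleteSpace H]
  [NormedAddCommGroup K] [NormedSpace ℂ K] [SMul 𝔄 K] [CStarModule 𝔄 K] [CompleteSpace K]
  [NormedAddCommGroup E] [NormedSpace ℂ E] [SMul 𝔄 E] [CStarModule 𝔄 E] [CompleteSpace E]

/-- A self-adjoint operator which is bounded below is invertible. -/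
theorem isUnit_of_adjoint_eq_of_bound {D : AdjointableMap 𝔄 H H}
    (hD : D.adjoint = D) {c : ℝ} (hc : 0 < c) (hb : ∀ x, c * ‖x‖ ≤ ‖D x‖) : IsUnit D := by
  have hanti : AntilipschitzWith (c⁻¹).toNNReal D.toCLM := by
    refine AddMonoidHomClass.antilipschitz_of_bound _ fun x => ?_
    rw [Real.coe_toNNReal _ (by positivity), ← div_eq_inv_mul, le_div_iff₀' hc]
    exact hb x
  obtain ⟨X, hX⟩ := D.isMPInvertible_of_isClosed_range
    (hanti.isClosed_range D.toCLM.uniformContinuous)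
  -- Injectivity cancels `D` in `DXD = D`; the adjoint of `XD = 1` then supplies a right inverse.
  have h1 : X * D = 1 := ext fun x => hanti.injective (hX.apply_apply_self x)
  have h2 : D * X.adjoint = 1 := by
    have h3 := congrArg adjoint h1
    rw [mul_eq_comp, adjoint_comp, hD] at h3
    exact h3
  exact ⟨⟨D, X, by rwa [← left_inv_eq_right_inv h1 h2] at h2, h1⟩, rfl⟩

/-- For a separated pair, decompositions along the two ranges are controlled in norm. -/
theorem IsSeparatedPair.exists_bound {A : AdjointableMap 𝔄 H K} {B : AdjointableMap 𝔄 H E}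
    (h : A.IsSeparatedPair B) :
    IsClosed (Set.range A.adjoint) ∧
      ∃ C : ℝ, 0 < C ∧ ∀ k e, ‖A.adjoint k‖ ≤ C * ‖A.adjoint k + B.adjoint e‖ := by
  set T : K × E →L[ℂ] H := A.adjoint.toCLM.coprod B.adjoint.toCLM with hT
  have hrange : (LinearMap.range (T : K × E →ₗ[ℂ] H) : Set H)
      = Set.range A.adjoint + Set.range B.adjoint := by
    ext y
    simp only [Set.mem_add, Set.mem_range, SetLike.mem_coe, LinearMap.mem_range]
    constructor
    · rintro ⟨z, rfl⟩
      exact ⟨_, ⟨z.1, rfl⟩, _, ⟨z.2, rfl⟩, rfl⟩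
    · rintro ⟨_, ⟨k, rfl⟩, _, ⟨e, rfl⟩, rfl⟩
      exact ⟨(k, e), rfl⟩
  set F := LinearMap.range (T : K × E →ₗ[ℂ] H) with hF
  have hFc : IsClosed (F : Set H) := by rw [hrange]; exact h.2
  have : CompleteSpace F := hFc.completeSpace_coe
  let T' : K × E →L[ℂ] F := T.codRestrict F fun z => ⟨z, rfl⟩
  have hT's : Function.Surjective T' := by
    rintro ⟨_, z, rfl⟩
    exact ⟨z, rfl⟩
  have hT'app : ∀ z, (T' z : H) = A.adjoint z.1 + B.adjoint z.2 := fun z => rfl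
  have hAF : ∀ k, A.adjoint k ∈ F := fun k => ⟨(k, 0), by simp [hT, map_zero]⟩
  constructor
  · have hcl : IsClosed ((Subtype.val : F → H) ⁻¹' Set.range A.adjoint) := by
      rw [← (T'.isQuotientMap hT's).isClosed_preimage]
      have : T' ⁻¹' ((Subtype.val : F → H) ⁻¹' Set.range A.adjoint)
          = {z | B.adjoint z.2 = 0} := by
        ext z
        simp only [Set.mem_preimage, hT'app, Set.mem_range, Set.mem_ofPred_eq]
        constructor
        · rintro ⟨k, hk⟩
          have h0 : A.adjoint k + B.adjoint 0 = A.adjoint z.1 + B.adjoint z.2 := by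
            rw [map_zero, add_zero, hk]
          have h1 := h.eq_of_add_eq h0
          rw [h1, map_zero] at h0
          exact (add_left_cancel h0).symm
        · intro hz
          exact ⟨z.1, by rw [hz, add_zero]⟩
      rw [this]
      exact isClosed_eq (B.adjoint.continuous.comp continuous_snd) continuous_const
    have himage : IsClosed ((Subtype.val : F → H) '' (Subtype.val ⁻¹' Set.range A.adjoint)) :=
      hFc.isClosedEmbedding_subtypeVal.isClosedMap _ hcl
    have hsub : Set.range A.adjoint ⊆ Set.range (Subtype.val : F → H) := by
      rintro _ ⟨k, rfl⟩
      exact ⟨⟨_, hAF k⟩, rfl⟩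
    rwa [Set.image_preimage_eq_of_subset hsub] at himage
  · obtain ⟨C, hC, hCT⟩ := T'.exists_preimage_norm_le hT's
    refine ⟨(‖A.adjoint.toCLM‖ + 1) * C, by positivity, fun k e => ?_⟩
    obtain ⟨z, hz, hzn⟩ := hCT (T' (k, e))
    have h1 : A.adjoint z.1 = A.adjoint k := h.eq_of_add_eq (congrArg Subtype.val hz)
    calc ‖A.adjoint k‖ = ‖A.adjoint.toCLM z.1‖ := by rw [← h1]; rfl
      _ ≤ (‖A.adjoint.toCLM‖ + 1) * ‖z‖ :=
          (A.adjoint.toCLM.le_opNorm _).trans (by gcongr; linarith; exact norm_fst_le z)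
      _ ≤ (‖A.adjoint.toCLM‖ + 1) * (C * ‖A.adjoint k + B.adjoint e‖) := by gcongr; exact hzn
      _ = _ := by ring

theorem IsSeparatedPair.isMPInvertible_left {A : AdjointableMap 𝔄 H K} {B : AdjointableMap 𝔄 H E}
    (h : A.IsSeparatedPair B) : A.IsMPInvertible :=
  (isMPInvertible_of_isClosed_range _ h.exists_bound.1).of_adjoint

/-- If `A⋆` has closed range and `V` is positive definite, then `A⋆ V A` is Moore-Penrose
invertible and its range contains that of `A⋆`. -/
theorem isMPInvertible_adjoint_comp_comp (A : AdjointableMap 𝔄 H K)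
    (hA : IsClosed (Set.range A.adjoint)) {V : AdjointableMap 𝔄 K K} (hV : V.IsPosDef) :
    (A.adjoint ∘ₐ V ∘ₐ A).IsMPInvertible ∧ ∀ k, ∃ x, (A.adjoint ∘ₐ V ∘ₐ A) x = A.adjoint k := by
  obtain ⟨S, rfl, hS⟩ := hV.exists_factor
  have hcl : IsClosed (Set.range (S ∘ₐ A).adjoint) := by
    have : Set.range (S ∘ₐ A).adjoint = Set.range A.adjoint := hS.range_comp A.adjoint
    rwa [this]
  obtain ⟨X, hX⟩ := (isMPInvertible_of_isClosed_range _ hcl).of_adjoint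
  refine ⟨⟨_, hX.adjoint_comp_self⟩, fun k => ?_⟩
  obtain ⟨l, rfl⟩ := hS k
  refine ⟨X l, ?_⟩
  have h1 := hX.adjoint.apply_apply_self l
  rw [← hX.adjoint.adjoint_apply_eq] at h1
  exact h1

/-- For a separated pair, `2 - A† A - B† B` is invertible. -/
theorem IsSeparatedPair.isUnit {A : AdjointableMap 𝔄 H K} {B : AdjointableMap 𝔄 H E}
    (h : A.IsSeparatedPair B) {X : AdjointableMap 𝔄 K H} {Y : AdjointableMap 𝔄 E H}
    (hX : A.IsMPInverse X) (hY : B.IsMPInverse Y) : IsUnit (2 - X ∘ₐ A - Y ∘ₐ B) := by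
  obtain ⟨-, C, hC, hb⟩ := h.exists_bound
  set D := 2 - X ∘ₐ A - Y ∘ₐ B with hD
  have hDapp : ∀ x, D x = (x - X (A x)) + (x - Y (B x)) := fun x => by
    have h2 : (2 : AdjointableMap 𝔄 H H) = 1 + 1 := one_add_one_eq_two.symm
    rw [hD, h2, sub_apply, sub_apply, add_apply, one_apply, comp_apply, comp_apply]
    abel
  have hDadj : D.adjoint = D := by
    have h2 : (2 : AdjointableMap 𝔄 H H) = 1 + 1 := one_add_one_eq_two.symm
    change star D = D
    rw [hD, star_sub, star_sub, h2, star_add, star_one, star_eq_adjoint, star_eq_adjoint,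
      hX.adjoint_comp_left, hY.adjoint_comp_left]
  refine isUnit_of_adjoint_eq_of_bound hDadj (c := ((2 * C + 1) ^ 2)⁻¹) (by positivity) fun x => ?_
  set u := x - X (A x) with hu
  set v := x - Y (B x) with hv
  have hinner : inner 𝔄 (D x) x = inner 𝔄 u u + inner 𝔄 v v := by
    rw [hDapp, CStarModule.inner_add_left, hX.inner_sub_apply_apply, hY.inner_sub_apply_apply]
  have hle : ‖inner 𝔄 (D x) x‖ ≤ ‖D x‖ * ‖x‖ := CStarModule.norm_inner_le H
  have hu2 : ‖u‖ ^ 2 ≤ ‖D x‖ * ‖x‖ := by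
    rw [CStarModule.norm_sq_eq 𝔄]
    refine (CStarAlgebra.norm_le_norm_of_nonneg_of_le CStarModule.inner_self_nonneg ?_).trans hle
    rw [hinner]
    exact le_add_of_nonneg_right CStarModule.inner_self_nonneg
  have hv2 : ‖v‖ ^ 2 ≤ ‖D x‖ * ‖x‖ := by
    rw [CStarModule.norm_sq_eq 𝔄]
    refine (CStarAlgebra.norm_le_norm_of_nonneg_of_le CStarModule.inner_self_nonneg ?_).trans hle
    rw [hinner]
    exact le_add_of_nonneg_left CStarModule.inner_self_nonneg
  -- The separation bound is applied to `Px - Qx = v - u`.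
  have hPx : ‖X (A x)‖ ≤ C * (‖u‖ + ‖v‖) := by
    have h1 := hb (X.adjoint x) (-Y.adjoint x)
    rw [map_neg, hX.adjoint_apply_eq, hY.adjoint_apply_eq] at h1
    have h2 : X (A x) + -Y (B x) = v - u := by rw [hu, hv]; abel
    rw [h2] at h1
    refine h1.trans ?_
    gcongr
    rw [add_comm]
    exact norm_sub_le v u
  have hx : ‖x‖ ≤ C * (‖u‖ + ‖v‖) + ‖u‖ := by
    calc ‖x‖ = ‖X (A x) + u‖ := by rw [hu, add_sub_cancel]
      _ ≤ _ := (norm_add_le _ _).trans (by gcongr)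
  rw [inv_mul_le_iff₀ (by positivity)]
  rcases eq_or_lt_of_le (norm_nonneg x) with h0 | h0
  · rw [← h0]; positivity
  -- Both `u` and `v` are at most `m`, so `‖x‖ ≤ (2C + 1)m`; squaring and cancelling `‖x‖` gives the
  -- constant.
  set m := √(‖D x‖ * ‖x‖) with hm
  have hum : ‖u‖ ≤ m := Real.le_sqrt_of_sq_le hu2
  have hvm : ‖v‖ ≤ m := Real.le_sqrt_of_sq_le hv2
  have hxm : ‖x‖ ≤ (2 * C + 1) * m := by
    calc ‖x‖ ≤ C * (m + m) + m := hx.trans (by gcongr)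
      _ = _ := by ring
  refine le_of_mul_le_mul_right ?_ h0
  calc ‖x‖ * ‖x‖ ≤ ((2 * C + 1) * m) * ((2 * C + 1) * m) := by gcongr
    _ = (2 * C + 1) ^ 2 * (m ^ 2) := by ring
    _ = _ := by rw [hm, Real.sq_sqrt (by positivity)]; ring

theorem IsSeparatedPair.isMPInvertible_right {A : AdjointableMap 𝔄 H K} {B : AdjointableMap 𝔄 H E}
    (h : A.IsSeparatedPair B) : B.IsMPInvertible :=
  h.symm.isMPInvertible_left

end AdjointableMap

/-! ### The formula for the weighted sum -/

theorem mainTheorem8 {𝔄 H K E : Type*}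
    [NonUnitalCStarAlgebra 𝔄] [PartialOrder 𝔄] [StarOrderedRing 𝔄]
    [NormedAddCommGroup H] [NormedSpace ℂ H] [SMul 𝔄 H] [CStarModule 𝔄 H] [CompleteSpace H]
    [NormedAddCommGroup K] [NormedSpace ℂ K] [SMul 𝔄 K] [CStarModule 𝔄 K] [CompleteSpace K]
    [NormedAddCommGroup E] [NormedSpace ℂ E] [SMul 𝔄 E] [CStarModule 𝔄 E] [CompleteSpace E]
    (A : AdjointableMap 𝔄 H K) (B : AdjointableMap 𝔄 H E) (hAB : A.IsSeparatedPair B)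
    (V : AdjointableMap 𝔄 K K) (hV : V.IsPosDef)
    (W : AdjointableMap 𝔄 E E) (hW : W.IsPosDef) :
    A.IsMPInvertible ∧ B.IsMPInvertible ∧
    (A.adjoint ∘ₐ V ∘ₐ A).IsMPInvertible ∧
    (A.adjoint ∘ₐ V ∘ₐ A + B.adjoint ∘ₐ W ∘ₐ B).IsMPInvertible ∧
    IsUnit (2 - A.mpInv ∘ₐ A - B.mpInv ∘ₐ B) ∧
    ∀ Pi : AdjointableMap 𝔄 K H,
      Pi = Ring.inverse (2 - A.mpInv ∘ₐ A - B.mpInv ∘ₐ B) ∘ₐ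
          (A.adjoint ∘ₐ V ∘ₐ A).mpInv ∘ₐ A.adjoint ∘ₐ V →
      (A.adjoint ∘ₐ V ∘ₐ A + B.adjoint ∘ₐ W ∘ₐ B).mpInv ∘ₐ A.adjoint ∘ₐ V =
        (A.adjoint ∘ₐ V ∘ₐ A).mpInv ∘ₐ A.adjoint ∘ₐ V - (1 - A.mpInv ∘ₐ A) ∘ₐ Pi := by
  have hA := hAB.isMPInvertible_left
  have hB := hAB.isMPInvertible_right
  have hA' := hA.isMPInverse_mpInv
  have hB' := hB.isMPInverse_mpInv
  have hunit := hAB.isUnit hA' hB'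
  obtain ⟨hclA, -⟩ := hAB.exists_bound
  obtain ⟨hclB, -⟩ := hAB.symm.exists_bound
  obtain ⟨hGA, hrA⟩ := A.isMPInvertible_adjoint_comp_comp hclA hV
  obtain ⟨-, hrB⟩ := B.isMPInvertible_adjoint_comp_comp hclB hW
  set GA := A.adjoint ∘ₐ V ∘ₐ A with hGAdef
  set GB := B.adjoint ∘ₐ W ∘ₐ B with hGBdef
  set P : AdjointableMap 𝔄 H H := A.mpInv ∘ₐ A with hP
  set Q : AdjointableMap 𝔄 H H := B.mpInv ∘ₐ B with hQ
  have hGAsa : GA.adjoint = GA :=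
    congrArg (fun S : AdjointableMap 𝔄 K K => A.adjoint ∘ₐ S ∘ₐ A) hV.isSelfAdjoint.star_eq
  have hGBsa : GB.adjoint = GB :=
    congrArg (fun S : AdjointableMap 𝔄 E E => B.adjoint ∘ₐ S ∘ₐ B) hW.isSelfAdjoint.star_eq
  have hMsa : (GA + GB).adjoint = GA + GB := by
    change star (GA + GB) = GA + GB
    rw [star_add, AdjointableMap.star_eq_adjoint, AdjointableMap.star_eq_adjoint, hGAsa, hGBsa]
  -- `Ring.inverse` is zero on non-units; `hunit` makes it a genuine inverse here.
  obtain ⟨Di, hDi⟩ : ∃ Di, Di = Ring.inverse (2 - P - Q) := ⟨_, rfl⟩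
  have hD1 : (2 - P - Q) * Di = 1 := by rw [hDi]; exact Ring.mul_inverse_cancel _ hunit
  have hD2 : Di * (2 - P - Q) = 1 := by rw [hDi]; exact Ring.inverse_mul_cancel _ hunit
  have hPP : P * P = P := AdjointableMap.ext fun x => congrArg _ (hA'.apply_apply_self x)
  have hQQ : Q * Q = Q := AdjointableMap.ext fun x => congrArg _ (hB'.apply_apply_self x)
  have hPN : P * ((1 - Q) * Di) = P := by
    calc P * ((1 - Q) * Di) = (P * (2 - P - Q) + (P * P - P)) * Di := by noncomm_ring
      _ = P * ((2 - P - Q) * Di) := by rw [hPP, sub_self, add_zero, mul_assoc]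
      _ = P := by rw [hD1, mul_one]
  have hQN : Q * ((1 - Q) * Di) = 0 := by
    rw [← mul_assoc, mul_sub, mul_one, hQQ, sub_self, zero_mul]
  have hNN : (1 - Q) * Di = 1 - (1 - P) * Di := by
    have h1 : (1 - Q) + (1 - P) = 2 - P - Q := by
      rw [← one_add_one_eq_two]
      abel
    rw [eq_sub_iff_add_eq, ← add_mul, h1, hD1]
  set N := (1 - Q) * Di with hN
  have hAN : ∀ x, A (N x) = A x := fun x => by
    have h1 : A.mpInv (A (N x)) = A.mpInv (A x) :=
      congrArg (fun S : AdjointableMap 𝔄 H H => S x) hPN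
    rw [← hA'.apply_apply_self (N x), h1, hA'.apply_apply_self]
  have hBN : ∀ x, B (N x) = 0 := fun x => by
    have h1 : B.mpInv (B (N x)) = 0 :=
      congrArg (fun S : AdjointableMap 𝔄 H H => S x) hQN
    rw [← hB'.apply_apply_self (N x), h1, B.map_zero]
  have hMN : ∀ x, (GA + GB) (N x) = GA x := fun x => by
    simp only [hGAdef, hGBdef, AdjointableMap.add_apply, AdjointableMap.comp_apply, hAN, hBN,
      AdjointableMap.map_zero, add_zero]
  have hMN' : ∀ x, (GA + GB) (x - N x) = GB x := fun x => by
    rw [AdjointableMap.map_sub, hMN, AdjointableMap.add_apply, add_sub_cancel_left]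
  have hrange : Set.range (GA + GB) = Set.range A.adjoint + Set.range B.adjoint := by
    refine Set.Subset.antisymm ?_ ?_
    · rintro _ ⟨x, rfl⟩
      exact ⟨_, ⟨V (A x), rfl⟩, _, ⟨W (B x), rfl⟩, rfl⟩
    · rintro _ ⟨_, ⟨k, rfl⟩, _, ⟨e, rfl⟩, rfl⟩
      obtain ⟨x, hx⟩ := hrA k
      obtain ⟨y, hy⟩ := hrB e
      -- `M` sends this witness to `GA x + GB y`.
      refine ⟨N x + (y - N y), ?_⟩
      rw [AdjointableMap.map_add, hMN, hMN', hx, hy]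
  have hM : (GA + GB).IsMPInvertible :=
    AdjointableMap.isMPInvertible_of_isClosed_range _ (hrange ▸ hAB.2)
  refine ⟨hA, hB, hGA, hM, hunit, ?_⟩
  rintro _ rfl
  rw [← hDi]
  have hM' := hM.isMPInverse_mpInv
  have hGA' := hGA.isMPInverse_mpInv
  set R : AdjointableMap 𝔄 H H := (GA + GB).mpInv ∘ₐ (GA + GB) with hR
  have hRfix : ∀ y ∈ Set.range A.adjoint + Set.range B.adjoint, R y = y := by
    rw [← hrange]
    rintro _ ⟨x, rfl⟩
    have h1 := hM'.apply_adjoint x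
    rwa [hMsa] at h1
  have hRP : R * P = P := AdjointableMap.ext fun x => hRfix _
    ⟨A.adjoint (A.mpInv.adjoint x), ⟨_, rfl⟩, 0, ⟨0, B.adjoint.map_zero⟩, by
      rw [hA'.adjoint_apply_eq]; exact add_zero _⟩
  have hRQ : R * Q = Q := AdjointableMap.ext fun x => hRfix _
    ⟨0, ⟨0, A.adjoint.map_zero⟩, B.adjoint (B.mpInv.adjoint x), ⟨_, rfl⟩, by
      rw [hB'.adjoint_apply_eq]; exact zero_add _⟩
  have hstar : star R = R ∧ star P = P ∧ star Q = Q :=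
    ⟨hM'.adjoint_comp_left, hA'.adjoint_comp_left, hB'.adjoint_comp_left⟩
  have hPR : P * R = P := by
    have h1 := congrArg star hRP
    rwa [star_mul, hstar.1, hstar.2.1] at h1
  have hQR : Q * R = Q := by
    have h1 := congrArg star hRQ
    rwa [star_mul, hstar.1, hstar.2.2] at h1
  -- `R` projects onto a space containing `R(P)` and `R(Q)`, so it commutes with both, hence with
  -- `D⁻¹`.
  have hcomm : Commute R (2 - P - Q) :=
    ((Commute.ofNat_right R 2).sub_right (hRP.trans hPR.symm)).sub_right (hRQ.trans hQR.symm)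
  have hcommDi : R * Di = Di * R := by
    calc R * Di = Di * (2 - P - Q) * R * Di := by rw [hD2, one_mul]
      _ = Di * (R * (2 - P - Q)) * Di := by rw [hcomm.eq]; noncomm_ring
      _ = Di * R * ((2 - P - Q) * Di) := by noncomm_ring
      _ = Di * R := by rw [hD1, mul_one]
  have hRN : R * (N * P) = N * P := by
    calc R * (N * P) = (R - R * Q) * Di * P := by rw [hN]; noncomm_ring
      _ = (R - Q * R) * Di * P := by rw [hRQ, hQR]
      _ = (1 - Q) * (R * Di) * P := by noncomm_ring
      _ = (1 - Q) * Di * (R * P) := by rw [hcommDi]; noncomm_ring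
      _ = N * P := by rw [hRP]
  ext k
  set z := GA.mpInv (A.adjoint (V k)) with hz
  have hGz : GA z = A.adjoint (V k) := by
    obtain ⟨x, hx⟩ := hrA (V k)
    rw [hz, ← hx, hGA'.apply_apply_self]
  -- `R(GA†) = R(GA⋆) = R(GA)`, which lies in `R(A⋆)`.
  have hPz : P z = z := by
    have h1 : z = GA (GA.mpInv.adjoint z) := by
      calc z = GA.mpInv (GA z) := by rw [hGz]
        _ = GA.adjoint (GA.mpInv.adjoint z) := (hGA'.adjoint_apply_eq z).symm
        _ = _ := by rw [hGAsa]
    rw [h1]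
    exact hA'.apply_adjoint _
  have hRNz : R (N z) = N z := by
    have h1 := congrArg (fun S : AdjointableMap 𝔄 H H => S z) hRN
    simp only [AdjointableMap.mul_apply, hPz] at h1
    exact h1
  have hNz : N z = z - (1 - P) (Di z) := by
    have h1 := congrArg (fun S : AdjointableMap 𝔄 H H => S z) hNN
    exact h1.trans (AdjointableMap.sub_apply _ _ _)
  rw [AdjointableMap.sub_apply]
  simp only [AdjointableMap.comp_apply]
  rw [← hz, ← hNz, ← hGz, ← hMN z]
  exact hRNz
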